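/- Let $N\ge 2$ be an integer and let $B_1^c=\{x\in\mathbb{R}^N : |x|>1\}$. Let $0<a<1$ and $\theta>0$, and put $\delta=-(N+\theta(1-a))$. Then there is a constant $C>0$, depending only on $N$, $a$ and $\theta$, such that for every real $r$ with $N<r\le \frac{N}{1-a}$ (in particular for $r=\frac{N}{1-a}$) and every real-valued $u\in C_c^\infty(B_1^c)$ (smooth, with support a compact subset of $B_1^c$), $$\left(\int_{B_1^c}|x|^{-(N+\theta)}|u|^r\,dx\right)^{\frac1r}\le C\left(\int_{B_1^c}|\nabla u|^N\,dx\right)^{\frac aN}\left(\int_{B_1^c}|x|^{-(N+\theta)}|u|^N\,dx\right)^{\frac{1-a}N}+C\left(\int_{B_1^c}|x|^{\delta}|u|^N\,dx\right)^{\frac1N}.$$ Since $a\in(0,1)$ is arbitrary, every $r\in(N,\infty)$ is covered, by taking $a\ge 1-\frac Nr$. -/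

import Mathlib

open MeasureTheory
open scoped ContDiff Gradient

/-- The exterior `{x : |x| > 1}` of the closed unit ball of `ℝ^N`. -/
def exteriorUnitBall (N : ℕ) : Set (EuclideanSpace ℝ (Fin N)) := {x | 1 < ‖x‖}

/-- `u ∈ C_c^∞(Ω)`: a smooth function (extended by zero to the whole space) whose support is
a compact subset of `Ω`. -/
structure IsTestFunction {N : ℕ} (Ω : Set (EuclideanSpace ℝ (Fin N)))
    (u : EuclideanSpace ℝ (Fin N) → ℝ) : Prop where
  smooth : ContDiff ℝ ∞ u
  compact_support : HasCompactSupport u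
  support_subset : tsupport u ⊆ Ω

open scoped ENNReal NNReal

/-! ### Unweighted Gagliardo-Nirenberg inequality on `ℝ^N` -/

section GagliardoNirenberg

variable {N : ℕ}

/-! Write `q = N / (1 - a)`, `σ = -(N + θ)`. The heart is the case `r = q`, proved on all of `ℝ^N`
in `lintegral_weighted_rpow_le`. The L¹ Sobolev inequality for powers of `u`, iterated and
interpolated, gives `∫ |u|^q ≤ K ‖∇u‖_N^(q-N) ∫ |u|^N`. A rescaled cutoff localizes this to `|x| ~
R` with a constant free of `R`, at the cost of adding `R⁻¹|u|` to the gradient. There `|x|^σ` is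
comparable to `R^σ`, and the extra term scales exactly as `(∫ |x|^δ |u|^N)^(q/N)`: this is what
fixes `δ`.

Summing over `R = 2^k` loses only a constant: the enlarged annuli overlap boundedly, the gradient
integral is kept global, and `q/N ≥ 1` lets the last terms be summed.

Smaller `r` follow from Hölder, since `|x|^σ dx` is finite on `{|x| > 1}`
(`lintegral_weighted_rpow_inv_le`), with a constant uniform in `r`. Estimates are made with
`lintegral`; finiteness for test functions allows the return to real integrals. -/

theorem holderConjugate_natCast (hN : 2 ≤ N) :
    Real.HolderConjugate (N : ℝ) ((N : ℝ) / ((N : ℝ) - 1)) := by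
  rw [Real.holderConjugate_iff]
  have h : (2 : ℝ) ≤ N := by exact_mod_cast hN
  refine ⟨by linarith, ?_⟩
  have : (N : ℝ) ≠ 0 := by linarith
  field_simp
  ring

theorem enorm_fderiv_pow {E : Type*} [NormedAddCommGroup E] [NormedSpace ℝ E] {u : E → ℝ}
    (hu : ContDiff ℝ 1 u) (n : ℕ) (x : E) :
    ‖fderiv ℝ (fun y => u y ^ n) x‖ₑ = n * (‖u x‖ₑ ^ (n - 1) * ‖fderiv ℝ u x‖ₑ) := by
  have hd : HasFDerivAt u (fderiv ℝ u x) x :=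
    (hu.differentiable one_ne_zero x).hasFDerivAt
  rw [(hd.pow n).fderiv, enorm_smul]
  simp [enorm_mul, mul_assoc, enorm_pow]

/-- Sobolev's inequality applied to the power `u ^ (n + 1)`. -/
theorem lintegral_rpow_succ_le (hN : 2 ≤ N) (n : ℕ) :
    ∃ K : ℝ≥0, ∀ u : EuclideanSpace ℝ (Fin N) → ℝ, ContDiff ℝ 1 u → HasCompactSupport u →
      ∫⁻ x, ‖u x‖ₑ ^ (((n : ℝ) + 1) * ((N : ℝ) / ((N : ℝ) - 1))) ≤
        K * (∫⁻ x, ‖fderiv ℝ u x‖ₑ ^ (N : ℝ)) ^ (1 / ((N : ℝ) - 1)) *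
          ∫⁻ x, ‖u x‖ₑ ^ ((n : ℝ) * ((N : ℝ) / ((N : ℝ) - 1))) := by
  have hc := holderConjugate_natCast hN
  set p : ℝ := (N : ℝ) / ((N : ℝ) - 1) with hp
  have hN2 : (2 : ℝ) ≤ N := by exact_mod_cast hN
  have hp0 : 0 < p := hc.symm.pos
  refine ⟨lintegralPowLePowLIntegralFDerivConst
    (volume : Measure (EuclideanSpace ℝ (Fin N))) p * ((n + 1 : ℕ) : ℝ≥0) ^ p, fun u hu hcu => ?_⟩
  have hcont : Continuous (fun x => fderiv ℝ u x) := hu.continuous_fderiv one_ne_zero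
  have hsob := lintegral_pow_le_pow_lintegral_fderiv
    (volume : Measure (EuclideanSpace ℝ (Fin N))) (u := fun y => u y ^ (n + 1)) (hu.pow _)
    (hcu.comp_left (g := fun t : ℝ => t ^ (n + 1)) (by simp)) (p := p) (by simpa using hc)
  have hl : ∀ x, ‖u x ^ (n + 1)‖ₑ ^ p = ‖u x‖ₑ ^ (((n : ℝ) + 1) * p) := fun x => by
    rw [enorm_pow, ← ENNReal.rpow_natCast, ← ENNReal.rpow_mul]; push_cast; rfl
  simp only [hl, enorm_fderiv_pow hu] at hsob
  refine hsob.trans ?_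
  have hm1 : Measurable fun x => ‖u x‖ₑ := hu.continuous.enorm.measurable
  have hm2 : Measurable fun x => ‖fderiv ℝ u x‖ₑ := hcont.enorm.measurable
  -- Hölder splits `|u|^n |∇u|` with exponents `p = N/(N-1)` and `N`; after the outer power `p`, the
  -- gradient integral carries `p/N = 1/(N-1)`.
  have hH := ENNReal.lintegral_mul_le_Lp_mul_Lq
    (volume : Measure (EuclideanSpace ℝ (Fin N))) hc.symm
    (f := fun x => ‖u x‖ₑ ^ n) (g := fun x => ‖fderiv ℝ u x‖ₑ)
    (hm1.pow_const n).aemeasurable hm2.aemeasurable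
  have hf : ∀ x, (‖u x‖ₑ ^ n) ^ p = ‖u x‖ₑ ^ ((n : ℝ) * p) := fun x => by
    rw [← ENNReal.rpow_natCast, ← ENNReal.rpow_mul]
  simp only [Pi.mul_apply, hf] at hH
  simp only [Nat.add_sub_cancel]
  rw [lintegral_const_mul (f := fun x => ‖u x‖ₑ ^ n * ‖fderiv ℝ u x‖ₑ) _
    ((hm1.pow_const _).mul hm2)]
  calc _ ≤ _ * (((n + 1 : ℕ) : ℝ≥0∞) * ((∫⁻ x, ‖u x‖ₑ ^ ((n : ℝ) * p)) ^ (1 / p) *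
          (∫⁻ x, ‖fderiv ℝ u x‖ₑ ^ (N : ℝ)) ^ (1 / (N : ℝ)))) ^ p := by gcongr
    _ = _ := by
      rw [ENNReal.mul_rpow_of_nonneg _ _ hp0.le, ENNReal.mul_rpow_of_nonneg _ _ hp0.le,
        ← ENNReal.rpow_mul, ← ENNReal.rpow_mul, one_div_mul_cancel hp0.ne', ENNReal.rpow_one]
      have : 1 / (N : ℝ) * p = 1 / ((N : ℝ) - 1) := by
        rw [hp]; have : (N : ℝ) ≠ 0 := by linarith
        field_simp
      rw [this, ENNReal.coe_mul, ENNReal.coe_rpow_of_nonneg _ hp0.le]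
      push_cast
      ring

/-- The Gagliardo-Nirenberg inequality at the exponents `N + m N / (N - 1)`. -/
theorem lintegral_rpow_add_natCast_mul_le (hN : 2 ≤ N) (m : ℕ) :
    ∃ K : ℝ≥0, ∀ u : EuclideanSpace ℝ (Fin N) → ℝ, ContDiff ℝ 1 u → HasCompactSupport u →
      ∫⁻ x, ‖u x‖ₑ ^ ((N : ℝ) + m * ((N : ℝ) / ((N : ℝ) - 1))) ≤
        K * (∫⁻ x, ‖fderiv ℝ u x‖ₑ ^ (N : ℝ)) ^ ((m : ℝ) / ((N : ℝ) - 1)) *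
          ∫⁻ x, ‖u x‖ₑ ^ (N : ℝ) := by
  have hN2 : (2 : ℝ) ≤ N := by exact_mod_cast hN
  have hN1 : (0 : ℝ) < (N : ℝ) - 1 := by linarith
  -- The power `n = N - 1` makes the right-hand exponent `n N/(N-1)` equal to `N`, so the iteration
  -- starts there.
  have key : ∀ j : ℕ, (((N - 1 + j : ℕ) : ℝ)) * ((N : ℝ) / ((N : ℝ) - 1)) =
      (N : ℝ) + j * ((N : ℝ) / ((N : ℝ) - 1)) := fun j => by
    rw [Nat.cast_add, Nat.cast_sub (by omega), Nat.cast_one]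
    field_simp
  induction m with
  | zero => exact ⟨1, fun u _ _ => by simp⟩
  | succ m ih =>
    obtain ⟨K, hK⟩ := ih
    obtain ⟨L, hL⟩ := lintegral_rpow_succ_le hN (N - 1 + m)
    refine ⟨L * K, fun u hu hcu => ?_⟩
    have h1 := hL u hu hcu
    have h2 := hK u hu hcu
    have e : (((N - 1 + m : ℕ) : ℝ) + 1) * ((N : ℝ) / ((N : ℝ) - 1)) =
        (N : ℝ) + (m + 1 : ℕ) * ((N : ℝ) / ((N : ℝ) - 1)) := by
      rw [add_mul, key]; push_cast; ring
    rw [key, e] at h1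
    refine h1.trans ((mul_le_mul_right h2 _).trans_eq ?_)
    have e2 : ((m + 1 : ℕ) : ℝ) / ((N : ℝ) - 1) = 1 / ((N : ℝ) - 1) + m / ((N : ℝ) - 1) := by
      push_cast; ring
    rw [e2, ENNReal.rpow_add_of_nonneg _ _ (by positivity) (by positivity)]
    push_cast
    ring

/-- The Gagliardo-Nirenberg inequality `‖u‖_q^q ≤ K ‖∇u‖_N^(q - N) ‖u‖_N^N` on `ℝ^N`. -/
theorem lintegral_rpow_le_fderiv (hN : 2 ≤ N) {q : ℝ} (hq : (N : ℝ) ≤ q) :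
    ∃ K : ℝ≥0, ∀ u : EuclideanSpace ℝ (Fin N) → ℝ, ContDiff ℝ 1 u → HasCompactSupport u →
      ∫⁻ x, ‖u x‖ₑ ^ q ≤
        K * (∫⁻ x, ‖fderiv ℝ u x‖ₑ ^ (N : ℝ)) ^ ((q - N) / N) * ∫⁻ x, ‖u x‖ₑ ^ (N : ℝ) := by
  have hN2 : (2 : ℝ) ≤ N := by exact_mod_cast hN
  have hN0 : (0 : ℝ) < N := by linarith
  have hp0 : 0 < (N : ℝ) / ((N : ℝ) - 1) := (holderConjugate_natCast hN).symm.pos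
  -- Go far enough that `q < N + d`; then `t` solves `(1 - t) N + t (N + d) = q`.
  obtain ⟨m, hm⟩ := exists_nat_gt ((q - N) / ((N : ℝ) / ((N : ℝ) - 1)))
  have hm0 : (0 : ℝ) < m := lt_of_le_of_lt (div_nonneg (by linarith) hp0.le) hm
  rw [div_lt_iff₀ hp0] at hm
  obtain ⟨K, hK⟩ := lintegral_rpow_add_natCast_mul_le hN m
  set d : ℝ := m * ((N : ℝ) / ((N : ℝ) - 1)) with hd
  have hd0 : 0 < d := by positivity
  set t : ℝ := (q - N) / d with ht
  have ht0 : 0 ≤ t := div_nonneg (by linarith) hd0.le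
  have ht1 : t ≤ 1 := by rw [ht, div_le_one hd0]; exact hm.le
  refine ⟨K ^ t, fun u hu hcu => ?_⟩
  have hm1 : Measurable fun x => ‖u x‖ₑ := hu.continuous.enorm.measurable
  have hI := ENNReal.lintegral_mul_norm_pow_le
    (μ := (volume : Measure (EuclideanSpace ℝ (Fin N))))
    (f := fun x => ‖u x‖ₑ ^ (N : ℝ)) (g := fun x => ‖u x‖ₑ ^ ((N : ℝ) + d))
    (hm1.pow_const _).aemeasurable (hm1.pow_const _).aemeasurable
    (p := 1 - t) (q := t) (by linarith) ht0 (by ring)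
  have hpt : ∀ x, (‖u x‖ₑ ^ (N : ℝ)) ^ (1 - t) * (‖u x‖ₑ ^ ((N : ℝ) + d)) ^ t = ‖u x‖ₑ ^ q := by
    intro x
    have h1t : 0 ≤ 1 - t := by linarith
    rw [← ENNReal.rpow_mul, ← ENNReal.rpow_mul,
      ← ENNReal.rpow_add_of_nonneg _ _ (by positivity) (by positivity)]
    congr 1
    have : t * d = q - N := by rw [ht]; field_simp
    linarith
  simp only [hpt] at hI
  refine hI.trans ((mul_le_mul_right (ENNReal.rpow_le_rpow (hK u hu hcu) ht0) _).trans_eq ?_)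
  rw [ENNReal.mul_rpow_of_nonneg _ _ ht0, ENNReal.mul_rpow_of_nonneg _ _ ht0, ← ENNReal.rpow_mul,
    ENNReal.coe_rpow_of_nonneg _ ht0]
  have e1 : (m : ℝ) / ((N : ℝ) - 1) * t = (q - N) / N := by
    have hN1 : (N : ℝ) - 1 ≠ 0 := by linarith
    rw [ht, hd]; field_simp
  rw [e1, mul_comm, mul_assoc, ← ENNReal.rpow_add_of_nonneg _ _ ht0 (by linarith)]
  simp

end GagliardoNirenberg

/-! ### Localization to annuli -/

section Localization

variable {N : ℕ}

theorem ENNReal.add_rpow_le_two_rpow_mul (x y : ℝ≥0∞) {s : ℝ} (hs : 0 ≤ s) :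
    (x + y) ^ s ≤ 2 ^ s * (x ^ s + y ^ s) := by
  rcases le_total x y with h | h
  · calc (x + y) ^ s ≤ (2 * y) ^ s := by rw [two_mul]; gcongr
      _ = 2 ^ s * y ^ s := ENNReal.mul_rpow_of_nonneg _ _ hs
      _ ≤ _ := by gcongr; exact le_add_self
  · calc (x + y) ^ s ≤ (2 * x) ^ s := by rw [two_mul]; gcongr
      _ = 2 ^ s * x ^ s := ENNReal.mul_rpow_of_nonneg _ _ hs
      _ ≤ _ := by gcongr; exact le_self_add

/-- Two-sided comparability is assumed because the weights have exponents of either sign: `hyz`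
serves `s ≥ 0`, `hzy` serves `s ≤ 0`. -/
theorem ENNReal.rpow_le_mul_rpow_of_comparable {c y z : ℝ≥0∞} (hc : c ≠ 0) (hc' : c ≠ ⊤)
    (hyz : y ≤ c * z) (hzy : z ≤ c * y) (s : ℝ) : y ^ s ≤ c ^ |s| * z ^ s := by
  rcases le_total 0 s with hs | hs
  · rw [abs_of_nonneg hs, ← ENNReal.mul_rpow_of_nonneg _ _ hs]
    gcongr
  · obtain ⟨t, rfl⟩ : ∃ t, s = -t := ⟨-s, by ring⟩
    have ht : 0 ≤ t := by linarith
    rw [abs_neg, abs_of_nonneg ht, ENNReal.rpow_neg, ENNReal.rpow_neg]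
    have h : z ^ t ≤ c ^ t * y ^ t := by
      rw [← ENNReal.mul_rpow_of_nonneg _ _ ht]; gcongr
    have h2 := ENNReal.inv_le_inv.2 h
    have h0 : c ^ t ≠ 0 := by
      simp [ENNReal.rpow_eq_zero_iff, hc, ht]
    have h1 : c ^ t ≠ ⊤ := ENNReal.rpow_ne_top_of_nonneg ht hc'
    rw [ENNReal.mul_inv (Or.inl h0) (Or.inl h1)] at h2
    calc (y ^ t)⁻¹ = c ^ t * ((c ^ t)⁻¹ * (y ^ t)⁻¹) := by
          rw [← mul_assoc, ENNReal.mul_inv_cancel h0 h1, one_mul]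
      _ ≤ _ := by gcongr

/-- The closed-open annulus `{x : a ≤ |x| < b}`. -/
def annulus (N : ℕ) (a b : ℝ) : Set (EuclideanSpace ℝ (Fin N)) := {x | a ≤ ‖x‖ ∧ ‖x‖ < b}

theorem measurableSet_annulus (a b : ℝ) : MeasurableSet (annulus N a b) :=
  (measurableSet_le measurable_const measurable_norm).inter
    (measurableSet_lt measurable_norm measurable_const)

/-- A smooth cutoff function for the annulus `{1 ≤ |x| < 2}`. -/
theorem exists_annulus_cutoff (N : ℕ) :
    ∃ (η : EuclideanSpace ℝ (Fin N) → ℝ) (M : ℝ≥0), ContDiff ℝ 1 η ∧ (∀ x, ‖η x‖ ≤ 1) ∧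
      (∀ x ∈ annulus N 1 2, η x = 1) ∧ (∀ x ∉ annulus N (1 / 2) 4, η x = 0) ∧
      (∀ x ∉ annulus N (1 / 2) 4, fderiv ℝ η x = 0) ∧ ∀ x, ‖fderiv ℝ η x‖ ≤ M := by
  -- The outer radius is 3, not 4, so that the closed support still lies in the half-open annulus.
  have hs : IsOpen {x : EuclideanSpace ℝ (Fin N) | 1 / 2 < ‖x‖ ∧ ‖x‖ < 3} :=
    (isOpen_lt continuous_const continuous_norm).inter (isOpen_lt continuous_norm continuous_const)
  have ht : IsClosed {x : EuclideanSpace ℝ (Fin N) | 1 ≤ ‖x‖ ∧ ‖x‖ ≤ 2} :=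
    (isClosed_le continuous_const continuous_norm).inter
      (isClosed_le continuous_norm continuous_const)
  obtain ⟨η, hη, hr, hsupp, h1⟩ := exists_contMDiff_support_eq_eq_one_iff
    (modelWithCornersSelf ℝ (EuclideanSpace ℝ (Fin N))) (n := 1) hs ht
    (fun x hx => ⟨by linarith [hx.1], by linarith [hx.2]⟩)
  have hη' : ContDiff ℝ 1 η := contMDiff_iff_contDiff.1 hη
  have htsupp : tsupport η ⊆ {x | 1 / 2 ≤ ‖x‖ ∧ ‖x‖ ≤ 3} := by
    refine closure_minimal ?_ ((isClosed_le continuous_const continuous_norm).inter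
      (isClosed_le continuous_norm continuous_const))
    rw [hsupp]
    exact fun x hx => ⟨hx.1.le, hx.2.le⟩
  have htsupp' : ∀ x ∉ annulus N (1 / 2) 4, x ∉ tsupport η := fun x hx h =>
    hx ⟨(htsupp h).1, by linarith [(htsupp h).2]⟩
  have hcs : HasCompactSupport η :=
    HasCompactSupport.of_support_subset_isCompact (isCompact_closedBall 0 3) (by
      rw [hsupp]; intro x hx; simpa using hx.2.le)
  obtain ⟨M, hM⟩ := (hη'.continuous_fderiv one_ne_zero).bounded_above_of_compact_support
    (hcs.fderiv ℝ)
  refine ⟨η, M.toNNReal, hη', fun x => ?_, fun x hx => (h1 x).1 ⟨hx.1, hx.2.le⟩,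
    fun x hx => image_eq_zero_of_notMem_tsupport (htsupp' x hx),
    fun x hx => ?_, fun x => (hM x).trans (Real.le_coe_toNNReal M)⟩
  · have := hr ⟨x, rfl⟩
    rw [Real.norm_of_nonneg this.1]; exact this.2
  · exact image_eq_zero_of_notMem_tsupport
      (fun h => htsupp' x hx (tsupport_fderiv_subset ℝ h))

/-- The Gagliardo-Nirenberg inequality on the annulus `{R ≤ |x| < 2R}`. -/
theorem lintegral_annulus_rpow_le (hN : 2 ≤ N) {q : ℝ} (hq : (N : ℝ) ≤ q) :
    ∃ K : ℝ≥0, ∀ R : ℝ, 0 < R → ∀ u : EuclideanSpace ℝ (Fin N) → ℝ, ContDiff ℝ 1 u →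
      HasCompactSupport u →
      ∫⁻ x in annulus N R (2 * R), ‖u x‖ₑ ^ q ≤
        K * ((∫⁻ x, ‖fderiv ℝ u x‖ₑ ^ (N : ℝ)) ^ ((q - N) / N) +
          (ENNReal.ofReal R ^ (-(N : ℝ)) *
            ∫⁻ x in annulus N (R / 2) (4 * R), ‖u x‖ₑ ^ (N : ℝ)) ^ ((q - N) / N)) *
          ∫⁻ x in annulus N (R / 2) (4 * R), ‖u x‖ₑ ^ (N : ℝ) := by
  have hN2 : (2 : ℝ) ≤ N := by exact_mod_cast hN
  have hN0 : (0 : ℝ) ≤ N := by linarith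
  obtain ⟨K, hK⟩ := lintegral_rpow_le_fderiv hN hq
  obtain ⟨η, M, hη, hη1, hηone, hηzero, hdη, hM⟩ := exists_annulus_cutoff N
  set s : ℝ := (q - N) / N with hs
  have hs0 : 0 ≤ s := div_nonneg (by linarith) hN0
  refine ⟨K * ((2 ^ (N : ℝ)) ^ s * (2 ^ s * (1 + (M ^ (N : ℝ)) ^ s))), fun R hR u hu hcu => ?_⟩
  set v : EuclideanSpace ℝ (Fin N) → ℝ := fun x => η (R⁻¹ • x) * u x with hv
  set A := annulus N R (2 * R) with hA
  set A' := annulus N (R / 2) (4 * R) with hA'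
  have hnorm : ∀ x : EuclideanSpace ℝ (Fin N), ‖R⁻¹ • x‖ = ‖x‖ / R := fun x => by
    rw [norm_smul, Real.norm_of_nonneg (by positivity)]; field_simp
  have hmem : ∀ x, x ∈ A → R⁻¹ • x ∈ annulus N 1 2 := fun x hx => by
    refine ⟨?_, ?_⟩ <;> rw [hnorm]
    · rw [le_div_iff₀ hR]; linarith [hx.1]
    · rw [div_lt_iff₀ hR]; exact hx.2
  have hmem' : ∀ x, x ∉ A' → R⁻¹ • x ∉ annulus N (1 / 2) 4 := fun x hx h => by
    refine hx ⟨?_, ?_⟩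
    · have := h.1; rw [hnorm, le_div_iff₀ hR] at this; linarith
    · have := h.2; rw [hnorm, div_lt_iff₀ hR] at this; exact this
  have hηR : ContDiff ℝ 1 (fun x => η (R⁻¹ • x)) := hη.comp (contDiff_const_smul _)
  have hvc : ContDiff ℝ 1 v := hηR.mul hu
  have hvs : HasCompactSupport v := hcu.mul_left
  have hle : ∀ x, ‖v x‖ₑ ^ (N : ℝ) ≤ A'.indicator (fun x => ‖u x‖ₑ ^ (N : ℝ)) x := fun x => by
    by_cases hx : x ∈ A'
    · rw [Set.indicator_of_mem hx]
      gcongr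
      rw [hv, enorm_mul]
      refine mul_le_of_le_one_left zero_le ?_
      rw [← ofReal_norm]
      simpa using hη1 (R⁻¹ • x)
    · rw [Set.indicator_of_notMem hx]
      simp [hv, hηzero _ (hmem' x hx)]
      linarith
  have hJ : ∫⁻ x, ‖v x‖ₑ ^ (N : ℝ) ≤ ∫⁻ x in A', ‖u x‖ₑ ^ (N : ℝ) := by
    rw [← lintegral_indicator (measurableSet_annulus _ _)]
    exact lintegral_mono hle
  have hI : ∫⁻ x in A, ‖u x‖ₑ ^ q ≤ ∫⁻ x, ‖v x‖ₑ ^ q := by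
    rw [← lintegral_indicator (measurableSet_annulus _ _)]
    refine lintegral_mono fun x => ?_
    by_cases hx : x ∈ A
    · rw [Set.indicator_of_mem hx]
      simp [hv, hηone _ (hmem x hx)]
    · rw [Set.indicator_of_notMem hx]; exact zero_le
  -- Product rule: rescaling bounds the cutoff's derivative by `M / R`, and it vanishes off `A'`.
  have hfd : ∀ x, ‖fderiv ℝ v x‖ₑ ≤ ‖fderiv ℝ u x‖ₑ +
      A'.indicator (fun x => M * ENNReal.ofReal R⁻¹ * ‖u x‖ₑ) x := fun x => by
    have h1 : HasFDerivAt (fun x => η (R⁻¹ • x)) (R⁻¹ • fderiv ℝ η (R⁻¹ • x)) x := by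
      have := (hη.differentiable one_ne_zero (R⁻¹ • x)).hasFDerivAt.comp x
        ((hasFDerivAt_id x).const_smul R⁻¹)
      refine this.congr_fderiv ?_
      ext y; simp
    have h2 : HasFDerivAt v _ x := h1.mul (hu.differentiable one_ne_zero x).hasFDerivAt
    rw [h2.fderiv]
    refine le_trans (enorm_add_le (η (R⁻¹ • x) • fderiv ℝ u x)
      (u x • R⁻¹ • fderiv ℝ η (R⁻¹ • x))) (add_le_add ?_ ?_)
    · rw [enorm_smul]
      refine mul_le_of_le_one_left zero_le ?_
      rw [← ofReal_norm]
      simpa using hη1 (R⁻¹ • x)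
    · by_cases hx : x ∈ A'
      · rw [Set.indicator_of_mem hx, enorm_smul, enorm_smul, mul_comm ‖u x‖ₑ,
          mul_comm ‖R⁻¹‖ₑ]
        gcongr
        · rw [← ofReal_norm, ← ENNReal.ofReal_coe_nnreal]
          exact ENNReal.ofReal_le_ofReal (hM _)
        · rw [Real.enorm_of_nonneg (by positivity)]
      · rw [Set.indicator_of_notMem hx, hdη _ (hmem' x hx)]
        simp
  have hD : ∫⁻ x, ‖fderiv ℝ v x‖ₑ ^ (N : ℝ) ≤ 2 ^ (N : ℝ) *
      ((∫⁻ x, ‖fderiv ℝ u x‖ₑ ^ (N : ℝ)) + M ^ (N : ℝ) * (ENNReal.ofReal R ^ (-(N : ℝ)) *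
        ∫⁻ x in A', ‖u x‖ₑ ^ (N : ℝ))) := by
    have hm1 : Measurable fun x => ‖u x‖ₑ := hu.continuous.enorm.measurable
    have hm2 : Measurable fun x => ‖fderiv ℝ u x‖ₑ :=
      (hu.continuous_fderiv one_ne_zero).enorm.measurable
    have hpt : ∀ x, ‖fderiv ℝ v x‖ₑ ^ (N : ℝ) ≤ 2 ^ (N : ℝ) * (‖fderiv ℝ u x‖ₑ ^ (N : ℝ) +
        M ^ (N : ℝ) * (ENNReal.ofReal R ^ (-(N : ℝ)) *
          A'.indicator (fun x => ‖u x‖ₑ ^ (N : ℝ)) x)) := fun x => by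
      refine (ENNReal.rpow_le_rpow (hfd x) hN0).trans
        ((ENNReal.add_rpow_le_two_rpow_mul _ _ hN0).trans_eq ?_)
      congr 2
      by_cases hx : x ∈ A'
      · rw [Set.indicator_of_mem hx, Set.indicator_of_mem hx, ENNReal.mul_rpow_of_nonneg _ _ hN0,
          ENNReal.mul_rpow_of_nonneg _ _ hN0, ENNReal.ofReal_inv_of_pos hR, ENNReal.inv_rpow,
          ENNReal.rpow_neg, mul_assoc]
      · rw [Set.indicator_of_notMem hx, Set.indicator_of_notMem hx]
        simp; omega
    refine (lintegral_mono hpt).trans_eq ?_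
    have hmi := (hm1.pow_const (N : ℝ)).indicator (measurableSet_annulus (N := N) (R / 2) (4 * R))
    rw [lintegral_const_mul _ (by fun_prop), lintegral_add_left (by fun_prop),
      lintegral_const_mul _ (by fun_prop), lintegral_const_mul _ (by fun_prop),
      lintegral_indicator (measurableSet_annulus _ _)]
  set D := ∫⁻ x, ‖fderiv ℝ u x‖ₑ ^ (N : ℝ)
  set J := ∫⁻ x in A', ‖u x‖ₑ ^ (N : ℝ)
  set F := ENNReal.ofReal R ^ (-(N : ℝ)) * J
  have hcoef : (∫⁻ x, ‖fderiv ℝ v x‖ₑ ^ (N : ℝ)) ^ s ≤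
      (2 ^ (N : ℝ)) ^ s * (2 ^ s * (1 + (M ^ (N : ℝ)) ^ s)) * (D ^ s + F ^ s) := by
    refine (ENNReal.rpow_le_rpow hD hs0).trans ?_
    rw [ENNReal.mul_rpow_of_nonneg _ _ hs0, mul_assoc]
    gcongr
    refine (ENNReal.add_rpow_le_two_rpow_mul _ _ hs0).trans ?_
    rw [ENNReal.mul_rpow_of_nonneg _ _ hs0, mul_assoc]
    gcongr
    rw [add_mul, one_mul]
    gcongr
    · exact le_self_add
    · exact le_add_self
  calc ∫⁻ x in A, ‖u x‖ₑ ^ q ≤ K * (∫⁻ x, ‖fderiv ℝ v x‖ₑ ^ (N : ℝ)) ^ s *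
        ∫⁻ x, ‖v x‖ₑ ^ (N : ℝ) := hI.trans (hK v hvc hvs)
    _ ≤ K * ((2 ^ (N : ℝ)) ^ s * (2 ^ s * (1 + (M ^ (N : ℝ)) ^ s)) * (D ^ s + F ^ s)) * J := by
      gcongr
    _ = _ := by
      push_cast [ENNReal.coe_rpow_of_nonneg _ hs0, ENNReal.coe_rpow_of_nonneg _ hN0]
      ring

end Localization

/-! ### Weights and dyadic summation -/

section DyadicSummation

variable {N : ℕ}

/-- The dyadic annulus `{2 ^ k ≤ |x| < 2 ^ (k + 1)}`. -/
def dyadicAnnulus (N : ℕ) (k : ℤ) : Set (EuclideanSpace ℝ (Fin N)) :=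
  annulus N ((2 : ℝ) ^ k) (2 * (2 : ℝ) ^ k)

theorem measurableSet_dyadicAnnulus (k : ℤ) : MeasurableSet (dyadicAnnulus N k) :=
  measurableSet_annulus _ _

theorem iUnion_dyadicAnnulus : ⋃ k, dyadicAnnulus N k = {0}ᶜ := by
  ext x
  simp only [Set.mem_iUnion, Set.mem_compl_iff, Set.mem_singleton_iff]
  constructor
  · rintro ⟨k, hk⟩ rfl
    have h : (0 : ℝ) < 2 ^ k := by positivity
    have := hk.1
    rw [norm_zero] at this
    linarith
  · intro hx
    obtain ⟨k, hk1, hk2⟩ := exists_mem_Ico_zpow (norm_pos_iff.2 hx) (one_lt_two : (1 : ℝ) < 2)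
    refine ⟨k, hk1, ?_⟩
    rwa [zpow_add_one₀ two_ne_zero, mul_comm] at hk2

theorem pairwise_disjoint_dyadicAnnulus :
    Pairwise (Function.onFun Disjoint (dyadicAnnulus N)) := by
  have key : ∀ j k : ℤ, j < k → Disjoint (dyadicAnnulus N j) (dyadicAnnulus N k) := by
    intro j k hjk
    rw [Set.disjoint_left]
    intro x hj hk
    have h1 : (2 : ℝ) ^ (j + 1) ≤ 2 ^ k := zpow_le_zpow_right₀ one_le_two (by omega)
    rw [zpow_add_one₀ two_ne_zero] at h1
    linarith [hj.2, hk.1]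
  intro j k hjk
  rcases lt_or_gt_of_ne hjk with h | h
  · exact key j k h
  · exact (key k j h).symm

theorem tsum_lintegral_dyadicAnnulus_le (f : EuclideanSpace ℝ (Fin N) → ℝ≥0∞) :
    ∑' k, ∫⁻ x in dyadicAnnulus N k, f x ≤ ∫⁻ x, f x := by
  rw [← lintegral_iUnion measurableSet_dyadicAnnulus pairwise_disjoint_dyadicAnnulus]
  exact setLIntegral_le_lintegral _ _

theorem lintegral_le_tsum_dyadicAnnulus (hN : 2 ≤ N) (f : EuclideanSpace ℝ (Fin N) → ℝ≥0∞) :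
    ∫⁻ x, f x ≤ ∑' k, ∫⁻ x in dyadicAnnulus N k, f x := by
  -- Positive dimension makes the origin, which no dyadic annulus contains, a null set.
  have : NeZero N := ⟨by omega⟩
  rw [← lintegral_iUnion measurableSet_dyadicAnnulus pairwise_disjoint_dyadicAnnulus,
    iUnion_dyadicAnnulus, restrict_compl_singleton]

/-- Bounded overlap: each enlarged annulus is covered by three consecutive dyadic ones. -/
theorem tsum_lintegral_fat_annulus_le (f : EuclideanSpace ℝ (Fin N) → ℝ≥0∞) :
    ∑' k : ℤ, ∫⁻ x in annulus N ((2 : ℝ) ^ k / 2) (4 * (2 : ℝ) ^ k), f x ≤ 3 * ∫⁻ x, f x := by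
  have hsub : ∀ k : ℤ, annulus N ((2 : ℝ) ^ k / 2) (4 * (2 : ℝ) ^ k) ⊆
      (dyadicAnnulus N (k + -1) ∪ dyadicAnnulus N k) ∪ dyadicAnnulus N (k + 1) := by
    intro k x hx
    have hm : (2 : ℝ) ^ (k + -1) = 2 ^ k / 2 := by
      rw [zpow_add₀ two_ne_zero, zpow_neg_one]; ring
    have hp : (2 : ℝ) ^ (k + 1) = 2 * 2 ^ k := by
      rw [zpow_add_one₀ two_ne_zero]; ring
    simp only [dyadicAnnulus, Set.mem_union, hm, hp]
    rcases lt_or_ge ‖x‖ ((2 : ℝ) ^ k) with h | h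
    · exact Or.inl (Or.inl ⟨hx.1, by linarith⟩)
    rcases lt_or_ge ‖x‖ (2 * (2 : ℝ) ^ k) with h' | h'
    · exact Or.inl (Or.inr ⟨h, h'⟩)
    · exact Or.inr ⟨h', by linarith [hx.2]⟩
  set I : ℤ → ℝ≥0∞ := fun k => ∫⁻ x in dyadicAnnulus N k, f x with hI
  have hle : ∀ k : ℤ, ∫⁻ x in annulus N ((2 : ℝ) ^ k / 2) (4 * (2 : ℝ) ^ k), f x ≤
      I (k + -1) + I k + I (k + 1) := fun k =>
    (lintegral_mono_set (hsub k)).trans ((lintegral_union_le _ _ _).trans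
      (add_le_add_left (lintegral_union_le _ _ _) _))
  have hshift : ∀ c : ℤ, ∑' k, I (k + c) = ∑' k, I k := fun c => (Equiv.addRight c).tsum_eq I
  calc _ ≤ ∑' k, (I (k + -1) + I k + I (k + 1)) := ENNReal.tsum_le_tsum hle
    _ = 3 * ∑' k, I k := by
      rw [ENNReal.tsum_add, ENNReal.tsum_add, hshift, hshift]; ring
    _ ≤ _ := by gcongr; exact tsum_lintegral_dyadicAnnulus_le f

theorem enorm_rpow_comparable {R : ℝ} (hR : 0 < R) {x : EuclideanSpace ℝ (Fin N)}
    (hx : x ∈ annulus N (R / 2) (4 * R)) (σ : ℝ) :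
    ‖x‖ₑ ^ σ ≤ 4 ^ |σ| * ENNReal.ofReal R ^ σ ∧ ENNReal.ofReal R ^ σ ≤ 4 ^ |σ| * ‖x‖ₑ ^ σ := by
  have h4 : (4 : ℝ≥0∞) = ENNReal.ofReal 4 := by norm_num
  have h1 : ‖x‖ₑ ≤ 4 * ENNReal.ofReal R := by
    rw [← ofReal_norm, h4, ← ENNReal.ofReal_mul (by norm_num)]
    exact ENNReal.ofReal_le_ofReal hx.2.le
  have h2 : ENNReal.ofReal R ≤ 4 * ‖x‖ₑ := by
    rw [← ofReal_norm, h4, ← ENNReal.ofReal_mul (by norm_num)]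
    exact ENNReal.ofReal_le_ofReal (by linarith [hx.1])
  exact ⟨ENNReal.rpow_le_mul_rpow_of_comparable (by simp) (by simp) h1 h2 σ,
    ENNReal.rpow_le_mul_rpow_of_comparable (by simp) (by simp) h2 h1 σ⟩

theorem rpow_mul_lintegral_annulus_le {R : ℝ} (hR : 0 < R) (σ : ℝ)
    {f : EuclideanSpace ℝ (Fin N) → ℝ≥0∞} (hf : Measurable f) :
    ENNReal.ofReal R ^ σ * ∫⁻ x in annulus N (R / 2) (4 * R), f x ≤
      4 ^ |σ| * ∫⁻ x in annulus N (R / 2) (4 * R), ‖x‖ₑ ^ σ * f x := by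
  rw [← lintegral_const_mul _ hf, ← lintegral_const_mul _ (by fun_prop)]
  refine setLIntegral_mono' (measurableSet_annulus _ _) fun x hx => ?_
  rw [← mul_assoc]
  gcongr
  exact (enorm_rpow_comparable hR hx σ).2

theorem lintegral_annulus_rpow_mul_le {R : ℝ} (hR : 0 < R) (σ : ℝ)
    {f : EuclideanSpace ℝ (Fin N) → ℝ≥0∞} (hf : Measurable f) :
    ∫⁻ x in annulus N R (2 * R), ‖x‖ₑ ^ σ * f x ≤
      4 ^ |σ| * (ENNReal.ofReal R ^ σ * ∫⁻ x in annulus N R (2 * R), f x) := by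
  rw [← mul_assoc, ← lintegral_const_mul _ hf]
  refine setLIntegral_mono' (measurableSet_annulus _ _) fun x hx => ?_
  gcongr
  exact (enorm_rpow_comparable hR ⟨by linarith [hx.1], by linarith [hx.2]⟩ σ).1

/-- The weighted Gagliardo-Nirenberg inequality on a single annulus. -/
theorem lintegral_annulus_weighted_le (hN : 2 ≤ N) {q : ℝ} (hq : (N : ℝ) ≤ q) (σ δ : ℝ)
    (hδ : δ * q = (σ + N - q) * N) :
    ∃ K : ℝ≥0, ∀ R : ℝ, 0 < R → ∀ u : EuclideanSpace ℝ (Fin N) → ℝ, ContDiff ℝ 1 u →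
      HasCompactSupport u →
      ∫⁻ x in annulus N R (2 * R), ‖x‖ₑ ^ σ * ‖u x‖ₑ ^ q ≤
        K * ((∫⁻ x, ‖fderiv ℝ u x‖ₑ ^ (N : ℝ)) ^ ((q - N) / N) *
            (∫⁻ x in annulus N (R / 2) (4 * R), ‖x‖ₑ ^ σ * ‖u x‖ₑ ^ (N : ℝ)) +
          (∫⁻ x in annulus N (R / 2) (4 * R), ‖x‖ₑ ^ δ * ‖u x‖ₑ ^ (N : ℝ)) ^ (q / N)) := by
  have hN2 : (2 : ℝ) ≤ N := by exact_mod_cast hN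
  have hN0 : (0 : ℝ) < N := by linarith
  have hq0 : 0 < q := by linarith
  obtain ⟨K, hK⟩ := lintegral_annulus_rpow_le hN hq
  set s : ℝ := (q - N) / N with hs
  have hs0 : 0 ≤ s := div_nonneg (by linarith) hN0.le
  have hqs : q / N = s + 1 := by rw [hs]; field_simp; ring
  have hqN : 0 ≤ q / N := by positivity
  refine ⟨4 ^ |σ| * K * (4 ^ |σ| + (4 ^ |δ|) ^ (q / N)), fun R hR u hu hcu => ?_⟩
  have hm1 : Measurable fun x => ‖u x‖ₑ := hu.continuous.enorm.measurable
  have h0 := lintegral_annulus_rpow_mul_le hR σ (hm1.pow_const q)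
  have h1 := hK R hR u hu hcu
  have h2 := rpow_mul_lintegral_annulus_le hR σ (hm1.pow_const (N : ℝ))
  have h3 := rpow_mul_lintegral_annulus_le hR δ (hm1.pow_const (N : ℝ))
  set D := ∫⁻ x, ‖fderiv ℝ u x‖ₑ ^ (N : ℝ)
  set J := ∫⁻ x in annulus N (R / 2) (4 * R), ‖u x‖ₑ ^ (N : ℝ)
  set B := ∫⁻ x in annulus N (R / 2) (4 * R), ‖x‖ₑ ^ σ * ‖u x‖ₑ ^ (N : ℝ)
  set E := ∫⁻ x in annulus N (R / 2) (4 * R), ‖x‖ₑ ^ δ * ‖u x‖ₑ ^ (N : ℝ)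
  set ρ := ENNReal.ofReal R with hρ
  have hρ0 : ρ ≠ 0 := by simpa [hρ] using hR
  have hρt : ρ ≠ ⊤ := ENNReal.ofReal_ne_top
  -- The powers of `R` match precisely because of `hδ`.
  have e : ρ ^ σ * ((ρ ^ (-(N : ℝ)) * J) ^ s * J) = (ρ ^ δ * J) ^ (q / N) := by
    rw [ENNReal.mul_rpow_of_nonneg _ _ hs0, ENNReal.mul_rpow_of_nonneg _ _ hqN,
      ← ENNReal.rpow_mul, ← ENNReal.rpow_mul]
    have e1 : δ * (q / N) = σ + -(N : ℝ) * s := by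
      rw [hs, ← mul_div_assoc, hδ]; field_simp; ring
    have e2 : J ^ (q / N) = J ^ s * J := by
      rw [hqs, ENNReal.rpow_add_of_nonneg _ _ hs0 zero_le_one, ENNReal.rpow_one]
    rw [e1, e2, ENNReal.rpow_add _ _ hρ0 hρt]
    ring
  calc _ ≤ 4 ^ |σ| * (ρ ^ σ * (K * (D ^ s + (ρ ^ (-(N : ℝ)) * J) ^ s) * J)) :=
        h0.trans (by gcongr)
    _ = 4 ^ |σ| * K * (D ^ s * (ρ ^ σ * J) + (ρ ^ δ * J) ^ (q / N)) := by
        rw [← e]; ring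
    _ ≤ 4 ^ |σ| * K * (D ^ s * (4 ^ |σ| * B) + (4 ^ |δ| * E) ^ (q / N)) := by gcongr
    _ ≤ 4 ^ |σ| * K * ((4 ^ |σ| + (4 ^ |δ|) ^ (q / N)) * (D ^ s * B + E ^ (q / N))) := by
        gcongr
        rw [ENNReal.mul_rpow_of_nonneg _ _ hqN, add_mul, mul_left_comm]
        gcongr
        · exact le_self_add
        · exact le_add_self
    _ = _ := by
        push_cast [ENNReal.coe_rpow_of_nonneg _ hqN, ENNReal.coe_rpow_of_nonneg _ (abs_nonneg σ),
          ENNReal.coe_rpow_of_nonneg _ (abs_nonneg δ)]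
        ring

/-- The weighted Gagliardo-Nirenberg inequality on `ℝ^N` at the extremal exponent. -/
theorem lintegral_weighted_rpow_le (hN : 2 ≤ N) {q : ℝ} (hq : (N : ℝ) ≤ q) (σ δ : ℝ)
    (hδ : δ * q = (σ + N - q) * N) :
    ∃ K : ℝ≥0, ∀ u : EuclideanSpace ℝ (Fin N) → ℝ, ContDiff ℝ 1 u → HasCompactSupport u →
      ∫⁻ x, ‖x‖ₑ ^ σ * ‖u x‖ₑ ^ q ≤
        K * ((∫⁻ x, ‖fderiv ℝ u x‖ₑ ^ (N : ℝ)) ^ ((q - N) / N) *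
            (∫⁻ x, ‖x‖ₑ ^ σ * ‖u x‖ₑ ^ (N : ℝ)) +
          (∫⁻ x, ‖x‖ₑ ^ δ * ‖u x‖ₑ ^ (N : ℝ)) ^ (q / N)) := by
  have hN2 : (2 : ℝ) ≤ N := by exact_mod_cast hN
  have hN0 : (0 : ℝ) < N := by linarith
  obtain ⟨K, hK⟩ := lintegral_annulus_weighted_le hN hq σ δ hδ
  set s : ℝ := (q - N) / N with hs
  have hs0 : 0 ≤ s := div_nonneg (by linarith) hN0.le
  have hqs : q / N = s + 1 := by rw [hs]; field_simp; ring
  refine ⟨K * 3, fun u hu hcu => ?_⟩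
  have hB := tsum_lintegral_fat_annulus_le (N := N) fun x => ‖x‖ₑ ^ σ * ‖u x‖ₑ ^ (N : ℝ)
  have hE := tsum_lintegral_fat_annulus_le (N := N) fun x => ‖x‖ₑ ^ δ * ‖u x‖ₑ ^ (N : ℝ)
  have hEk : ∀ k : ℤ, ∫⁻ x in annulus N ((2 : ℝ) ^ k / 2) (4 * (2 : ℝ) ^ k),
      ‖x‖ₑ ^ δ * ‖u x‖ₑ ^ (N : ℝ) ≤ ∫⁻ x, ‖x‖ₑ ^ δ * ‖u x‖ₑ ^ (N : ℝ) :=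
    fun k => setLIntegral_le_lintegral _ _
  have hk := fun k : ℤ => hK ((2 : ℝ) ^ k) (by positivity) u hu hcu
  set D := ∫⁻ x, ‖fderiv ℝ u x‖ₑ ^ (N : ℝ)
  set B := ∫⁻ x, ‖x‖ₑ ^ σ * ‖u x‖ₑ ^ (N : ℝ)
  set E := ∫⁻ x, ‖x‖ₑ ^ δ * ‖u x‖ₑ ^ (N : ℝ)
  set b : ℤ → ℝ≥0∞ := fun k => ∫⁻ x in annulus N ((2 : ℝ) ^ k / 2) (4 * (2 : ℝ) ^ k),
    ‖x‖ₑ ^ σ * ‖u x‖ₑ ^ (N : ℝ)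
  set e : ℤ → ℝ≥0∞ := fun k => ∫⁻ x in annulus N ((2 : ℝ) ^ k / 2) (4 * (2 : ℝ) ^ k),
    ‖x‖ₑ ^ δ * ‖u x‖ₑ ^ (N : ℝ)
  have hpow : ∀ y : ℝ≥0∞, y ^ (q / N) = y ^ s * y := fun y => by
    rw [hqs, ENNReal.rpow_add_of_nonneg _ _ hs0 zero_le_one, ENNReal.rpow_one]
  calc _ ≤ ∑' k, ∫⁻ x in dyadicAnnulus N k, ‖x‖ₑ ^ σ * ‖u x‖ₑ ^ q :=
        lintegral_le_tsum_dyadicAnnulus hN _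
    _ ≤ ∑' k, K * (D ^ s * b k + E ^ s * e k) := by
        -- Since `q/N = s + 1` with `s ≥ 0`, `e k ^ (q/N) ≤ E ^ s * e k`, which is linear in the
        -- summable piece.
        refine ENNReal.tsum_le_tsum fun k => (hk k).trans ?_
        change K * (D ^ s * b k + e k ^ (q / N)) ≤ _
        rw [hpow]
        gcongr
        exact hEk k
    _ = K * (D ^ s * ∑' k, b k + E ^ s * ∑' k, e k) := by
        rw [ENNReal.tsum_mul_left, ENNReal.tsum_add, ENNReal.tsum_mul_left, ENNReal.tsum_mul_left]
    _ ≤ K * (D ^ s * (3 * B) + E ^ s * (3 * E)) := by gcongr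
    _ = _ := by rw [hpow]; push_cast; ring

end DyadicSummation

/-! ### The exterior domain: finite measure and passage to real integrals -/

section ExteriorDomain

variable {N : ℕ}

theorem measurableSet_exteriorUnitBall : MeasurableSet (exteriorUnitBall N) :=
  measurableSet_lt measurable_const measurable_norm

theorem lintegral_exteriorUnitBall_rpow_lt_top {σ : ℝ} (hσ : σ < -N) :
    ∫⁻ x in exteriorUnitBall N, ‖x‖ₑ ^ σ < ⊤ := by
  have hN0 : (0 : ℝ) ≤ N := Nat.cast_nonneg N
  have hfin := finite_integral_one_add_norm
    (μ := (volume : Measure (EuclideanSpace ℝ (Fin N)))) (r := -σ)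
    (by rw [finrank_euclideanSpace_fin]; linarith)
  -- For `|x| > 1`, `1 + |x| ≤ 2|x|`, and `σ` is negative; this compares with the integrable `(1 +
  -- |x|)^σ`.
  have hle : ∫⁻ x in exteriorUnitBall N, ‖x‖ₑ ^ σ ≤
      ENNReal.ofReal (2 ^ (-σ)) *
        ∫⁻ x : EuclideanSpace ℝ (Fin N), ENNReal.ofReal ((1 + ‖x‖) ^ (-(-σ))) := by
    rw [← lintegral_const_mul' _ _ ENNReal.ofReal_ne_top]
    refine le_trans (setLIntegral_mono' measurableSet_exteriorUnitBall fun x hx => ?_)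
      (setLIntegral_le_lintegral _ _)
    have hx1 : 1 < ‖x‖ := hx
    have hx0 : 0 < ‖x‖ := by linarith
    rw [← ofReal_norm, ENNReal.ofReal_rpow_of_pos hx0, ← ENNReal.ofReal_mul (by positivity),
      neg_neg]
    refine ENNReal.ofReal_le_ofReal ?_
    calc ‖x‖ ^ σ = 2 ^ (-σ) * (2 * ‖x‖) ^ σ := by
          rw [Real.mul_rpow (by norm_num) hx0.le, ← mul_assoc, ← Real.rpow_add (by norm_num)]
          simp
      _ ≤ 2 ^ (-σ) * (1 + ‖x‖) ^ σ := by
          gcongr ?_ * ?_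
          exact Real.rpow_le_rpow_of_nonpos (by linarith) (by linarith) (by linarith)
  exact hle.trans_lt (ENNReal.mul_lt_top ENNReal.ofReal_lt_top hfin)

namespace IsTestFunction

variable {u : EuclideanSpace ℝ (Fin N) → ℝ}

theorem eq_zero_of_notMem (hu : IsTestFunction (exteriorUnitBall N) u)
    {x : EuclideanSpace ℝ (Fin N)} (hx : x ∉ exteriorUnitBall N) : u x = 0 :=
  image_eq_zero_of_notMem_tsupport fun h => hx (hu.support_subset h)

theorem fderiv_eq_zero_of_notMem (hu : IsTestFunction (exteriorUnitBall N) u)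
    {x : EuclideanSpace ℝ (Fin N)} (hx : x ∉ exteriorUnitBall N) : fderiv ℝ u x = 0 :=
  image_eq_zero_of_notMem_tsupport fun h => hx (hu.support_subset (tsupport_fderiv_subset ℝ h))

theorem setLIntegral_weighted (hu : IsTestFunction (exteriorUnitBall N) u) (σ : ℝ) {p : ℝ}
    (hp : 0 < p) :
    ∫⁻ x in exteriorUnitBall N, ‖x‖ₑ ^ σ * ‖u x‖ₑ ^ p = ∫⁻ x, ‖x‖ₑ ^ σ * ‖u x‖ₑ ^ p := by
  refine setLIntegral_eq_of_support_subset ?_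
  intro x hx
  by_contra h
  exact hx (by simp [hu.eq_zero_of_notMem h, hp])

theorem lintegral_weighted_lt_top (hu : IsTestFunction (exteriorUnitBall N) u) {σ p : ℝ}
    (hσ : σ ≤ 0) (hp : 0 < p) : ∫⁻ x, ‖x‖ₑ ^ σ * ‖u x‖ₑ ^ p < ⊤ := by
  have hmem : MemLp u (ENNReal.ofReal p) :=
    hu.smooth.continuous.memLp_of_hasCompactSupport hu.compact_support
  have hfin := lintegral_rpow_enorm_lt_top_of_eLpNorm_lt_top (by simpa using hp)
    ENNReal.ofReal_ne_top hmem.2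
  rw [ENNReal.toReal_ofReal hp.le] at hfin
  rw [← hu.setLIntegral_weighted σ hp]
  refine lt_of_le_of_lt ?_ hfin
  refine le_trans (setLIntegral_mono' measurableSet_exteriorUnitBall fun x hx => ?_)
    (setLIntegral_le_lintegral _ _)
  refine mul_le_of_le_one_left zero_le ?_
  have hx1 : 1 ≤ ‖x‖ₑ := by
    rw [← ofReal_norm, ENNReal.one_le_ofReal]; exact le_of_lt hx
  rcases hσ.eq_or_lt with rfl | h
  · simp
  · exact ENNReal.rpow_le_one_of_one_le_of_neg hx1 h

theorem integral_weighted_eq (hu : IsTestFunction (exteriorUnitBall N) u) (σ : ℝ) {p : ℝ}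
    (hp : 0 < p) :
    ∫ x in exteriorUnitBall N, ‖x‖ ^ σ * |u x| ^ p =
      (∫⁻ x, ‖x‖ₑ ^ σ * ‖u x‖ₑ ^ p).toReal := by
  have hc : Measurable u := hu.smooth.continuous.measurable
  rw [integral_eq_lintegral_of_nonneg_ae (Filter.Eventually.of_forall fun x => by positivity)
    (Measurable.aestronglyMeasurable (by fun_prop)), ← hu.setLIntegral_weighted σ hp]
  congr 1
  refine setLIntegral_congr_fun measurableSet_exteriorUnitBall fun x hx => ?_
  have hx0 : 0 < ‖x‖ := lt_trans one_pos hx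
  rw [ENNReal.ofReal_mul (by positivity), ← ENNReal.ofReal_rpow_of_pos hx0,
    ← ENNReal.ofReal_rpow_of_nonneg (abs_nonneg _) hp.le, ofReal_norm, ← Real.norm_eq_abs,
    ofReal_norm]

theorem lintegral_fderiv_lt_top (hu : IsTestFunction (exteriorUnitBall N) u) {p : ℝ}
    (hp : 0 < p) : ∫⁻ x, ‖fderiv ℝ u x‖ₑ ^ p < ⊤ := by
  have hmem : MemLp (fderiv ℝ u) (ENNReal.ofReal p) :=
    (hu.smooth.continuous_fderiv (by simp)).memLp_of_hasCompactSupport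
      (hu.compact_support.fderiv ℝ)
  have hfin := lintegral_rpow_enorm_lt_top_of_eLpNorm_lt_top (by simpa using hp)
    ENNReal.ofReal_ne_top hmem.2
  rwa [ENNReal.toReal_ofReal hp.le] at hfin

theorem integral_gradient_eq (hu : IsTestFunction (exteriorUnitBall N) u) {p : ℝ} (hp : 0 < p) :
    ∫ x in exteriorUnitBall N, ‖∇ u x‖ ^ p = (∫⁻ x, ‖fderiv ℝ u x‖ₑ ^ p).toReal := by
  have hg : ∀ x, ‖∇ u x‖ = ‖fderiv ℝ u x‖ := fun x => by simp [gradient]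
  have hc : Continuous (fderiv ℝ u) := hu.smooth.continuous_fderiv (by simp)
  simp only [hg]
  rw [integral_eq_lintegral_of_nonneg_ae (Filter.Eventually.of_forall fun x => by positivity)
    (Measurable.aestronglyMeasurable (hc.norm.measurable.pow_const p))]
  congr 1
  have h1 : ∀ x, ENNReal.ofReal (‖fderiv ℝ u x‖ ^ p) = ‖fderiv ℝ u x‖ₑ ^ p := fun x => by
    rw [← ENNReal.ofReal_rpow_of_nonneg (norm_nonneg _) hp.le, ofReal_norm]
  simp only [h1]
  refine setLIntegral_eq_of_support_subset ?_
  intro x hx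
  by_contra h
  refine hx ?_
  change ‖fderiv ℝ u x‖ₑ ^ p = 0
  rw [hu.fderiv_eq_zero_of_notMem h, ← ofReal_norm, norm_zero, ENNReal.ofReal_zero,
    ENNReal.zero_rpow_of_pos hp]

/-- Lowering the exponent with respect to the finite measure `|x| ^ σ dx` on `{|x| > 1}`. -/
theorem lintegral_weighted_rpow_inv_le (hu : IsTestFunction (exteriorUnitBall N) u) (σ : ℝ)
    {r q : ℝ} (hr : 1 ≤ r) (hrq : r ≤ q) :
    (∫⁻ x, ‖x‖ₑ ^ σ * ‖u x‖ₑ ^ r) ^ (1 / r) ≤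
      (∫⁻ x, ‖x‖ₑ ^ σ * ‖u x‖ₑ ^ q) ^ (1 / q) *
        (1 + ∫⁻ x in exteriorUnitBall N, ‖x‖ₑ ^ σ) := by
  have hr0 : 0 < r := by linarith
  have hq0 : 0 < q := by linarith
  have hm : Measurable fun x => ‖u x‖ₑ := hu.smooth.continuous.enorm.measurable
  have ht : r / q ≤ 1 := (div_le_one hq0).2 hrq
  have ht0 : 0 ≤ r / q := by positivity
  rw [← hu.setLIntegral_weighted σ hr0, ← hu.setLIntegral_weighted σ hq0]
  have hH := ENNReal.lintegral_mul_norm_pow_le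
    (μ := (volume : Measure (EuclideanSpace ℝ (Fin N))).restrict (exteriorUnitBall N))
    (f := fun x => ‖x‖ₑ ^ σ * ‖u x‖ₑ ^ q) (g := fun x => ‖x‖ₑ ^ σ)
    (by fun_prop) (by fun_prop) ht0 (sub_nonneg.2 ht) (by ring)
  have hpt : ∀ x : EuclideanSpace ℝ (Fin N),
      (‖x‖ₑ ^ σ * ‖u x‖ₑ ^ q) ^ (r / q) * (‖x‖ₑ ^ σ) ^ (1 - r / q) =
      ‖x‖ₑ ^ σ * ‖u x‖ₑ ^ r := fun x => by
    rw [ENNReal.mul_rpow_of_nonneg _ _ ht0, ← ENNReal.rpow_mul ‖u x‖ₑ, mul_div_cancel₀ _ hq0.ne',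
      mul_right_comm, ← ENNReal.rpow_add_of_nonneg _ _ ht0 (sub_nonneg.2 ht)]
    simp
  simp only [hpt] at hH
  set W := ∫⁻ x in exteriorUnitBall N, ‖x‖ₑ ^ σ
  refine (ENNReal.rpow_le_rpow hH (by positivity)).trans ?_
  rw [ENNReal.mul_rpow_of_nonneg _ _ (by positivity), ← ENNReal.rpow_mul, ← ENNReal.rpow_mul]
  have e : r / q * (1 / r) = 1 / q := by field_simp
  rw [e]
  gcongr
  -- The exponent of `W` lies in `[0, 1]`, so `1 + W` bounds the power uniformly in `r`.
  have h0 : 0 ≤ (1 - r / q) * (1 / r) := mul_nonneg (sub_nonneg.2 ht) (by positivity)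
  have h1 : (1 - r / q) * (1 / r) ≤ 1 :=
    mul_le_one₀ (by linarith) (by positivity) ((div_le_one hr0).2 hr)
  calc W ^ ((1 - r / q) * (1 / r)) ≤ (1 + W) ^ ((1 - r / q) * (1 / r)) := by
        gcongr; exact le_add_self
    _ ≤ (1 + W) ^ (1 : ℝ) := ENNReal.rpow_le_rpow_of_exponent_le le_self_add h1
    _ = 1 + W := ENNReal.rpow_one _

end IsTestFunction

end ExteriorDomain

/-! ### The main inequality -/

theorem theorem1p1 (N : ℕ) (hN : 2 ≤ N) (a θ δ : ℝ) (ha₀ : 0 < a) (ha₁ : a < 1) (hθ : 0 < θ)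
    (hδ : δ = -((N : ℝ) + θ * (1 - a))) :
    ∃ C : ℝ, 0 < C ∧ ∀ r : ℝ, (N : ℝ) < r → r ≤ (N : ℝ) / (1 - a) →
      ∀ u : EuclideanSpace ℝ (Fin N) → ℝ, IsTestFunction (exteriorUnitBall N) u →
        (∫ x in exteriorUnitBall N, ‖x‖ ^ (-((N : ℝ) + θ)) * |u x| ^ r) ^ (1 / r) ≤
          C * (∫ x in exteriorUnitBall N, ‖∇ u x‖ ^ (N : ℝ)) ^ (a / (N : ℝ)) *
              (∫ x in exteriorUnitBall N, ‖x‖ ^ (-((N : ℝ) + θ)) * |u x| ^ (N : ℝ)) ^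
                ((1 - a) / (N : ℝ)) +
            C * (∫ x in exteriorUnitBall N, ‖x‖ ^ δ * |u x| ^ (N : ℝ)) ^ (1 / (N : ℝ)) := by
  have hN2 : (2 : ℝ) ≤ N := by exact_mod_cast hN
  have hN0 : (0 : ℝ) < N := by linarith
  have ha1 : 0 < 1 - a := by linarith
  set q : ℝ := (N : ℝ) / (1 - a) with hqdef
  have hqa : q * (1 - a) = N := by rw [hqdef]; field_simp
  have hq : (N : ℝ) ≤ q := by rw [hqdef, le_div_iff₀ ha1]; nlinarith
  have hq0 : 0 < q := by linarith
  set σ : ℝ := -((N : ℝ) + θ) with hσ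
  have hσN : σ < -N := by linarith
  have hδ0 : δ ≤ 0 := by rw [hδ]; have := mul_pos hθ ha1; linarith
  have hδq : δ * q = (σ + N - q) * N := by
    rw [hδ, hσ]
    linear_combination (-θ) * hqa
  obtain ⟨K, hK⟩ := lintegral_weighted_rpow_le hN hq σ δ hδq
  have hW := lintegral_exteriorUnitBall_rpow_lt_top hσN
  set W := ∫⁻ x in exteriorUnitBall N, ‖x‖ₑ ^ σ
  have hKt : (K : ℝ≥0∞) ^ (1 / q) ≠ ⊤ :=
    ENNReal.rpow_ne_top_of_nonneg (by positivity) ENNReal.coe_ne_top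
  set L : ℝ≥0∞ := (K : ℝ≥0∞) ^ (1 / q) * (1 + W) with hL
  have hLt : L ≠ ⊤ := ENNReal.mul_ne_top hKt (by simpa using hW.ne)
  -- The added 1 only secures positivity.
  refine ⟨L.toReal + 1, by positivity, fun r hr hrq u hu => ?_⟩
  have hr0 : 0 < r := by linarith
  have hA := hu.lintegral_weighted_rpow_inv_le σ (by linarith) hrq
  have hB := hK u (hu.smooth.of_le (by simp)) hu.compact_support
  have hDt := (hu.lintegral_fderiv_lt_top hN0).ne
  have hBt := (hu.lintegral_weighted_lt_top (σ := σ) (by linarith) hN0).ne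
  have hEt := (hu.lintegral_weighted_lt_top hδ0 hN0).ne
  rw [hu.integral_weighted_eq σ hr0, hu.integral_weighted_eq σ hN0, hu.integral_weighted_eq δ hN0,
    hu.integral_gradient_eq hN0]
  set D := ∫⁻ x, ‖fderiv ℝ u x‖ₑ ^ (N : ℝ)
  set B := ∫⁻ x, ‖x‖ₑ ^ σ * ‖u x‖ₑ ^ (N : ℝ)
  set E := ∫⁻ x, ‖x‖ₑ ^ δ * ‖u x‖ₑ ^ (N : ℝ)
  set A := ∫⁻ x, ‖x‖ₑ ^ σ * ‖u x‖ₑ ^ r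
  have hq1 : 0 ≤ 1 / q := by positivity
  have e1 : (q - N) / N * (1 / q) = a / N := by
    have : q - N = q * a := by linarith
    rw [this]; field_simp
  have e2 : 1 / q = (1 - a) / N := by rw [hqdef]; field_simp
  have e3 : q / N * (1 / q) = 1 / N := by field_simp
  have hmain : A ^ (1 / r) ≤ L * (D ^ (a / N) * B ^ ((1 - a) / N) + E ^ (1 / (N : ℝ))) := by
    calc A ^ (1 / r) ≤ (K * (D ^ ((q - N) / N) * B + E ^ (q / N))) ^ (1 / q) * (1 + W) :=
          hA.trans (by gcongr)
      _ = L * (D ^ ((q - N) / N) * B + E ^ (q / N)) ^ (1 / q) := by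
          rw [ENNReal.mul_rpow_of_nonneg _ _ hq1, hL]; ring
      -- The `q`-th root is subadditive because `q ≥ 1`.
      _ ≤ L * ((D ^ ((q - N) / N) * B) ^ (1 / q) + (E ^ (q / N)) ^ (1 / q)) := by
          gcongr
          exact ENNReal.rpow_add_le_add_rpow _ _ hq1 ((div_le_one hq0).2 (by linarith))
      _ = _ := by
          rw [ENNReal.mul_rpow_of_nonneg _ _ hq1, ← ENNReal.rpow_mul, ← ENNReal.rpow_mul, e1, e3,
            e2]
  have hDp : D ^ (a / N) ≠ ⊤ := ENNReal.rpow_ne_top_of_nonneg (by positivity) hDt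
  have hBp : B ^ ((1 - a) / N) ≠ ⊤ := ENNReal.rpow_ne_top_of_nonneg (by positivity) hBt
  have hEp : E ^ (1 / (N : ℝ)) ≠ ⊤ := ENNReal.rpow_ne_top_of_nonneg (by positivity) hEt
  clear_value L
  have hreal := ENNReal.toReal_mono
    (ENNReal.mul_ne_top hLt (ENNReal.add_ne_top.2 ⟨ENNReal.mul_ne_top hDp hBp, hEp⟩)) hmain
  rw [ENNReal.toReal_mul, ENNReal.toReal_add (ENNReal.mul_ne_top hDp hBp) hEp, ENNReal.toReal_mul,
    ← ENNReal.toReal_rpow, ← ENNReal.toReal_rpow, ← ENNReal.toReal_rpow, ← ENNReal.toReal_rpow]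
    at hreal
  have hpos : 0 ≤ D.toReal ^ (a / N) * B.toReal ^ ((1 - a) / N) + E.toReal ^ (1 / (N : ℝ)) := by
    positivity
  linarith
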